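/- **Setting.** An object $B$ with the single query $\bot$ is a probability distribution $B(\bot)$ on $\{0,1\}^n\times\{0,1\}$. The sample-access object induced by $f:\{0,1\}^n\to\{0,1\}$ returns $(x,f(x))$ for uniformly random $x\in\{0,1\}^n$. A model $M$ is a probability distribution over objects. A distinguisher $D$ is a (randomized) Boolean circuit that, given access to an object $B$, reads the answers to some number of queries, each drawn independently from $B(\bot)$, and accepts or rejects; $D^B$ denotes its output. Circuits have gates computing constants or arbitrary Boolean functions of two bits; the size of a circuit is the number of its input bits (including random bits) plus the number of its gates, where in a circuit with oracle gates an oracle gate asking a string of length $l$ counts $l+1$. A model $M$ has circuit complexity at most $W$ if it has an implementation by a circuit $T$ of size at most $W$, that is: either an ordinary implementation, in which for every seed $r\in\{0,1\}^\ell$ the output $T(r)$ (random over internal random bits of $T$) is distributed as $B_r(\bot)$ for some object $B_r$, and $B_r\sim M$ for uniformly random $r$; or a random-oracle implementation, in which the same holds with $r$ a uniformly random function $\{0,1\}^*\to\{0,1\}$ to which $T$ has oracle access. **Theorem.** There are absolute constants $C,K>0$ and $d\in\mathbb N$ such that the following holds. Let $n,W>1$ be integers with $W\log_2 W\le 2^n/C$.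 Then there exist a function $f^*:\{0,1\}^n\to\{0,1\}$, inducing the sample-access object $B^*$, and a distinguisher $D$ of circuit complexity at most $K\,nW\,(\log_2(nW))^d$ (that is, $\tilde O(nW)$) such that for every model $M$ of circuit complexity at most $W$, $$\Big|\Pr[D^{B^*}=\text{``accept''}]-\mathbb E_{B\sim M}\big[\Pr[D^{B}=\text{``accept''}]\big]\Big|>\frac13 .$$ -/

import Mathlib

open MeasureTheory

namespace Indist

/-! ### Boolean circuits, possibly with oracle gates -/

/-- A gate whose predecessors are nodes of type `ν`: a constant, a Boolean function of two
nodes, or a query to one of the oracles indexed by `κ` (on a string of any length). -/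
inductive Gate (κ ν : Type) : Type
  | const (b : Bool) : Gate κ ν
  | binop (op : Bool → Bool → Bool) (i j : ν) : Gate κ ν
  | query (o : κ) (args : List ν) : Gate κ ν

/-- The value of a gate, given the oracles `r` and the values `v` of the nodes. -/
def Gate.eval {κ ν : Type} (r : κ → List Bool → Bool) (v : ν → Bool) : Gate κ ν → Bool
  | .const b => b
  | .binop op i j => op (v i) (v j)
  | .query o args => r o (args.map v)

/-- An ordinary gate costs `1`; an oracle gate is also charged for the string it asks. -/
def Gate.cost {κ ν : Type} : Gate κ ν → ℕ
  | .const _ => 1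
  | .binop _ _ _ => 1
  | .query _ args => args.length + 1

/-- A straight-line program of `g` gates over inputs `ι`: the predecessors of each gate are
inputs and earlier gates. -/
inductive Program (κ ι : Type) : ℕ → Type
  | nil : Program κ ι 0
  | snoc {g : ℕ} (P : Program κ ι g) (γ : Gate κ (ι ⊕ Fin g)) : Program κ ι (g + 1)

/-- The values of all nodes (inputs and gates) of a program on the input `x`. -/
def Program.eval {κ ι : Type} (r : κ → List Bool → Bool) (x : ι → Bool) :
    {g : ℕ} → Program κ ι g → ι ⊕ Fin g → Bool
  | _, .nil => Sum.elim x Fin.elim0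
  | _, .snoc P γ =>
      Sum.elim x (Fin.snoc (α := fun _ => Bool) (fun i => P.eval r x (Sum.inr i))
        (γ.eval r (P.eval r x)))

/-- Total cost of the gates of a program. -/
def Program.cost {κ ι : Type} : {g : ℕ} → Program κ ι g → ℕ
  | _, .nil => 0
  | _, .snoc P γ => P.cost + γ.cost

/-- A circuit with input bits indexed by `ι` and output bits indexed by `β`, each output
bit being the value of some node. `κ = Empty` gives ordinary Boolean circuits, and
`κ = Unit` circuits with access to one oracle `{0,1}^* → {0,1}`. -/
structure Circuit (κ ι β : Type) where
  gateCount : ℕ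
  program : Program κ ι gateCount
  out : β → ι ⊕ Fin gateCount

/-- The output of a circuit with oracles `r` on input `x`. -/
def Circuit.eval {κ ι β : Type} (T : Circuit κ ι β) (r : κ → List Bool → Bool)
    (x : ι → Bool) : β → Bool :=
  fun b => T.program.eval r x (T.out b)

/-- The output of an ordinary circuit on input `x`. -/
def Circuit.run {ι β : Type} (T : Circuit Empty ι β) (x : ι → Bool) : β → Bool :=
  T.eval (fun o => o.elim) x

/-- Circuit size: number of inputs plus total cost of the gates (for an ordinary circuit,
the number of nodes). -/
def Circuit.size {κ ι β : Type} [Fintype ι] (T : Circuit κ ι β) : ℕ :=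
  Fintype.card ι + T.program.cost

/-! ### Objects, models and implementations -/

/-- An object maps a query to a distribution over answers. -/
abbrev Object (Q A : Type) : Type := Q → PMF A

/-- A model is a distribution over objects. -/
abbrev Model (Q A : Type) : Type := PMF (Object Q A)

/-- The sample-access object induced by `f`: the only query is `⊥ = ()`, and the answer is
`(x, f x)` for a uniformly random `x`. -/
noncomputable def sampleAccess {X Y : Type} [Fintype X] [Nonempty X] (f : X → Y) :
    Object Unit (X × Y) :=
  fun _ => (PMF.uniformOfFintype X).map (fun x => (x, f x))

/-- Points of `{0,1}^n`. -/
abbrev Cube (n : ℕ) : Type := Fin n → Bool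

/-- Answers `(x, y)` with `x ∈ {0,1}^n` and `y ∈ {0,1}`. -/
abbrev Answer (n : ℕ) : Type := Cube n × Bool

/-- Positions of the `n + 1` bits of an answer. -/
abbrev AnswerBit (n : ℕ) : Type := Fin n ⊕ Unit

/-- The bits of an answer. -/
def Answer.bits {n : ℕ} (a : Answer n) : AnswerBit n → Bool :=
  Sum.elim a.1 (fun _ => a.2)

/-- The answer with given bits. -/
def Answer.ofBits {n : ℕ} (v : AnswerBit n → Bool) : Answer n :=
  (fun i => v (Sum.inl i), v (Sum.inr ()))

/-- `T`, with seed `r ∈ {0,1}^ℓ` and `t` internal random bits, is an ordinary implementation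
of `M`: for every seed `r` the output of `T` is distributed according to `B r`, and `B r` is
distributed according to `M` for uniformly random `r`. -/
def IsOrdinaryImplementation {n ℓ t : ℕ} (T : Circuit Empty (Fin ℓ ⊕ Fin t) (AnswerBit n))
    (M : Model Unit (Answer n)) : Prop :=
  ∃ B : Cube ℓ → Object Unit (Answer n),
    (∀ r q, (PMF.uniformOfFintype (Cube t)).map
      (fun s => Answer.ofBits (T.run (Sum.elim r s))) = B r q) ∧
    (PMF.uniformOfFintype (Cube ℓ)).map B = M

/-- The law of a uniformly random function `{0,1}^* → {0,1}`. -/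
noncomputable def randomOracle : Measure (List Bool → Bool) :=
  Measure.infinitePi (fun _ => (PMF.uniformOfFintype Bool).toMeasure)

/-- `T`, an oracle circuit with `t` internal random bits, is a random-oracle implementation
of `M`: for every oracle `r` the output of `T` is distributed according to `B r`, and `B r`
is distributed according to `M` for a uniformly random function `r`. -/
def IsRandomOracleImplementation {n t : ℕ} (T : Circuit Unit (Fin t) (AnswerBit n))
    (M : Model Unit (Answer n)) : Prop :=
  ∃ B : (List Bool → Bool) → Object Unit (Answer n),
    (∀ r q, (PMF.uniformOfFintype (Cube t)).map
      (fun s => Answer.ofBits (T.eval (fun _ => r) s)) = B r q) ∧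
    ∀ B₀ : Object Unit (Answer n), randomOracle {r | B r = B₀} = M B₀

/-- The model `M` has circuit complexity at most `W`: it has an ordinary or a random-oracle
implementation by a circuit of size at most `W`. -/
def ModelComplexityLE {n : ℕ} (M : Model Unit (Answer n)) (W : ℕ) : Prop :=
  (∃ (ℓ t : ℕ) (T : Circuit Empty (Fin ℓ ⊕ Fin t) (AnswerBit n)),
    IsOrdinaryImplementation T M ∧ T.size ≤ W) ∨
  (∃ (t : ℕ) (T : Circuit Unit (Fin t) (AnswerBit n)),
    IsRandomOracleImplementation T M ∧ T.size ≤ W)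

/-! ### Distinguishers -/

/-- A distinguisher for objects with the single query `⊥`: a circuit reading the answers to
`queries` many queries and `coins` many random bits. (As there is only one query, which query
to ask never depends on earlier answers.) -/
structure Distinguisher (n : ℕ) where
  queries : ℕ
  coins : ℕ
  circuit : Circuit Empty ((Fin queries × AnswerBit n) ⊕ Fin coins) Unit

/-- The circuit complexity of a distinguisher; every bit of every answer is counted. -/
def Distinguisher.size {n : ℕ} (D : Distinguisher n) : ℕ := D.circuit.size

/-- `m` independent draws from `p`. -/
noncomputable def iid {α : Type} (p : PMF α) : (m : ℕ) → PMF (Fin m → α)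
  | 0 => PMF.pure Fin.elim0
  | m + 1 => p.bind fun a => (iid p m).bind fun v => PMF.pure (Fin.cons a v)

/-- The random variable `D^B`, where `true` means "accept": each query is answered by an
independent draw from `B ⊥`. -/
noncomputable def Distinguisher.output {n : ℕ} (D : Distinguisher n)
    (B : Object Unit (Answer n)) : PMF Bool :=
  (iid (B ()) D.queries).bind fun a =>
    (PMF.uniformOfFintype (Cube D.coins)).map fun s =>
      D.circuit.run (Sum.elim (fun p => (a p.1).bits p.2) s) ()

/-- `Pr[D^B = "accept"]`. -/
noncomputable def Distinguisher.acceptProb {n : ℕ} (D : Distinguisher n)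
    (B : Object Unit (Answer n)) : ℝ :=
  (D.output B true).toReal

/-- `E_{B ∼ M}[Pr[D^B = "accept"]]`. -/
noncomputable def Distinguisher.expectedAcceptProb {n : ℕ} (D : Distinguisher n)
    (M : Model Unit (Answer n)) : ℝ :=
  (∑' B, M B * D.output B true).toReal

end Indist

/-! Let `f` depend only on the first `m` bits, where `N = 2 ^ m` is of order `W log W`, and project
every sample to those bits and its label. The distinguisher compares one label with `f` by table
lookup and checks that each of `k = N / 16` fresh pairs of samples has distinct projected points.
The true object always passes the label check, and passes the collision check with probability `(1 -
1/N) ^ k ≥ 15/16` (`accept_graph_ge`).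

For one fixed object, `card_accept_le` shows that few `f` lead to acceptance with probability above
`9/16`. If the collision probability is at least `16/N`, the collision check alone passes with
probability at most `exp (-1) < 9/16`, whatever `f` is. Otherwise the marginal on points is spread
out, so the agreement with a random `f` is a weighted sum of independent signs around `1/2`, and
Hoeffding bounds the exceptional fraction by `exp (-N/2048)`.

Markov's inequality over `B ∼ M` carries this to a fixed model, at the cost of an extra `1/48` in
the acceptance probability (`card_mean_mul_le`). Acceptance depends on the model only through its
projection, and `finite_restrictModel` bounds the number of projections of models of complexity at
most `W` by `2 ^ O(W log W)`. Since `N` is a large multiple of `W log W`, a union bound leaves some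
`f` that works against all of them (`exists_function_of_count`).

Projecting serves twice: the lookup table has only `N` entries, and the count of output wirings does
not involve `n`. -/

namespace Indist

open scoped ENNReal

/-! ### Boolean formulas and their compilation to circuits -/

/-- `HasFormula s φ`: the Boolean function `φ` is computed by a formula with at most `s` constants
and binary connectives. -/
inductive HasFormula {ι : Type} : ℕ → ((ι → Bool) → Bool) → Prop
  | var (i : ι) : HasFormula 0 (fun x => x i)
  | const (b : Bool) : HasFormula 1 (fun _ => b)
  | binop (op : Bool → Bool → Bool) {s t : ℕ} {φ ψ : (ι → Bool) → Bool}
      (hφ : HasFormula s φ) (hψ : HasFormula t ψ) :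
      HasFormula (s + t + 1) (fun x => op (φ x) (ψ x))

theorem Program.eval_inl {κ ι : Type} (r : κ → List Bool → Bool) (x : ι → Bool) {g : ℕ}
    (P : Program κ ι g) (i : ι) : P.eval r x (Sum.inl i) = x i := by
  cases P <;> rfl

theorem Program.eval_snoc_castSucc {κ ι : Type} (r : κ → List Bool → Bool) (x : ι → Bool) {g : ℕ}
    (P : Program κ ι g) (γ : Gate κ (ι ⊕ Fin g)) (v : ι ⊕ Fin g) :
    (P.snoc γ).eval r x (Sum.map id Fin.castSucc v) = P.eval r x v := by
  cases v with
  | inl i => simp [Program.eval_inl]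
  | inr i => simp [Program.eval]

theorem Program.eval_snoc_last {κ ι : Type} (r : κ → List Bool → Bool) (x : ι → Bool) {g : ℕ}
    (P : Program κ ι g) (γ : Gate κ (ι ⊕ Fin g)) :
    (P.snoc γ).eval r x (Sum.inr (Fin.last g)) = γ.eval r (P.eval r x) := by
  simp [Program.eval]

/-- A program can be extended so as to compute a given formula in one of its nodes. -/
theorem HasFormula.exists_program {κ ι : Type} {s : ℕ} {φ : (ι → Bool) → Bool}
    (h : HasFormula s φ) {g : ℕ} (P : Program κ ι g) :
    ∃ (g' : ℕ) (P' : Program κ ι g') (e : ι ⊕ Fin g → ι ⊕ Fin g') (o : ι ⊕ Fin g'),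
      P'.cost ≤ P.cost + s ∧ (∀ r x v, P'.eval r x (e v) = P.eval r x v) ∧
        ∀ r x, P'.eval r x o = φ x := by
  induction h generalizing g with
  | var i => exact ⟨g, P, id, Sum.inl i, le_rfl, fun _ _ _ => rfl, fun r x => P.eval_inl r x i⟩
  | const b =>
    exact ⟨g + 1, P.snoc (.const b), Sum.map id Fin.castSucc, Sum.inr (Fin.last g), le_rfl,
      fun r x v => P.eval_snoc_castSucc r x _ v, fun r x => P.eval_snoc_last r x _⟩
  | binop op _ _ ih₁ ih₂ =>
    obtain ⟨g₁, P₁, e₁, o₁, c₁, h₁, k₁⟩ := ih₁ P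
    obtain ⟨g₂, P₂, e₂, o₂, c₂, h₂, k₂⟩ := ih₂ P₁
    -- Compiling the second operand extends the program again, so the output node `o₁` of the first
    -- has to be transported along `e₂`.
    refine ⟨g₂ + 1, P₂.snoc (.binop op (e₂ o₁) o₂), fun v => Sum.map id Fin.castSucc (e₂ (e₁ v)),
      Sum.inr (Fin.last g₂), ?_, fun r x v => ?_, fun r x => ?_⟩
    · simp only [Program.cost, Gate.cost]; omega
    · rw [Program.eval_snoc_castSucc, h₂, h₁]
    · rw [Program.eval_snoc_last, Gate.eval, h₂, k₁, k₂]

theorem HasFormula.exists_circuit {ι : Type} [Fintype ι] {s : ℕ} {φ : (ι → Bool) → Bool}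
    (h : HasFormula s φ) :
    ∃ T : Circuit Empty ι Unit, T.size ≤ Fintype.card ι + s ∧ ∀ x, T.run x () = φ x := by
  obtain ⟨g, P, -, o, c, -, k⟩ := h.exists_program (Program.nil (κ := Empty))
  refine ⟨⟨g, P, fun _ => o⟩, ?_, fun x => k _ x⟩
  simp only [Program.cost, zero_add] at c
  exact Nat.add_le_add_left c _

theorem HasFormula.forall_fin {ι : Type} {s k : ℕ} {φ : Fin k → (ι → Bool) → Bool}
    (h : ∀ i, HasFormula s (φ i)) :
    HasFormula (k * (s + 1) + 1) (fun x => decide (∀ i, φ i x = true)) := by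
  induction k with
  | zero => simpa using HasFormula.const true
  | succ k ih =>
    convert HasFormula.binop and (h 0) (ih fun i => h i.succ) using 1
    · ring
    · ext x
      simp [Fin.forall_fin_succ]

theorem HasFormula.exists_fin {ι : Type} {s k : ℕ} {φ : Fin k → (ι → Bool) → Bool}
    (h : ∀ i, HasFormula s (φ i)) :
    HasFormula (k * (s + 1) + 1) (fun x => decide (∃ i, φ i x = true)) := by
  induction k with
  | zero => simpa using HasFormula.const false
  | succ k ih =>
    convert HasFormula.binop or (h 0) (ih fun i => h i.succ) using 1
    · ring
    · ext x
      simp [Fin.exists_fin_succ]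

/-- Table lookup. -/
theorem HasFormula.lookup {ι : Type} {m : ℕ} (f : Cube m → Bool) (v : Fin m → ι) :
    HasFormula (4 * 2 ^ m - 3) (fun x => f (fun i => x (v i))) := by
  induction m with
  | zero =>
    have h (x : ι → Bool) : (fun i => x (v i)) = Fin.elim0 := Subsingleton.elim (α := Cube 0) _ _
    simp only [h]
    exact HasFormula.const (f Fin.elim0)
  | succ m ih =>
    have h (b : Bool) := ih (fun y => f (Fin.cons b y)) (fun i => v i.succ)
    -- A multiplexer on the first bit: two smaller tables and three connectives, so the size obeys
    -- `a (m + 1) = 2 * a m + 3` with `a 0 = 1`.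
    have key := HasFormula.binop or (HasFormula.binop and (.var (v 0)) (h true))
      (HasFormula.binop (fun a b => !a && b) (.var (v 0)) (h false))
    convert key using 1
    · have := Nat.one_le_two_pow (n := m)
      rw [pow_succ]; omega
    · ext x
      have hx : (fun i => x (v i)) = Fin.cons (x (v 0)) (fun i => x (v (Fin.succ i))) := by
        ext i
        refine Fin.cases ?_ (fun j => ?_) i <;> simp
      rw [hx]
      cases x (v 0) <;> simp

/-! ### The distinguisher -/

/-- The test on `2 k + 1` labelled points: the first one must be labelled by `f`, and the points of
each of the `k` further pairs must differ. -/
def labelCollisionTest {X : Type} [DecidableEq X] (f : X → Bool) {k : ℕ}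
    (a : Fin (2 * k + 1) → X × Bool) : Bool :=
  ((a 0).2 == f (a 0).1) &&
    decide (∀ i : Fin k, (a ⟨2 * i + 1, by omega⟩).1 ≠ (a ⟨2 * i + 2, by omega⟩).1)

/-- Keep only some of the bits of the point. -/
def restrictAnswer {m n : ℕ} (e : Fin m → Fin n) (a : Answer n) : Answer m :=
  (fun i => a.1 (e i), a.2)

theorem exists_circuit_labelCollisionTest {m n : ℕ} (e : Fin m → Fin n) (f : Cube m → Bool)
    (k : ℕ) :
    ∃ T : Circuit Empty ((Fin (2 * k + 1) × AnswerBit n) ⊕ Fin 0) Unit,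
      T.size ≤ (2 * k + 1) * (n + 1) + (4 * 2 ^ m + 1 + k * (2 * m + 2)) ∧
      ∀ (a : Fin (2 * k + 1) → Answer n) (s : Cube 0),
        T.run (Sum.elim (fun p => (a p.1).bits p.2) s) () =
          labelCollisionTest f (fun i => restrictAnswer e (a i)) := by
  let ι := (Fin (2 * k + 1) × AnswerBit n) ⊕ Fin 0
  let pt (i : Fin (2 * k + 1)) (j : Fin m) : ι := Sum.inl (i, Sum.inl (e j))
  have h₁ := HasFormula.binop (fun a b => a == b)
    (HasFormula.var (ι := ι) (Sum.inl (0, Sum.inr ()))) (HasFormula.lookup f (pt 0))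
  have h₂ := HasFormula.forall_fin (k := k) fun i => HasFormula.exists_fin (k := m) fun j =>
    HasFormula.binop xor (HasFormula.var (pt ⟨2 * i + 1, by omega⟩ j))
      (HasFormula.var (pt ⟨2 * i + 2, by omega⟩ j))
  obtain ⟨T, hT, hrun⟩ := (HasFormula.binop and h₁ h₂).exists_circuit
  refine ⟨T, hT.trans ?_, fun a s => ?_⟩
  · have := Nat.one_le_two_pow (n := m)
    simp only [ι, AnswerBit, Fintype.card_sum, Fintype.card_prod, Fintype.card_fin,
      Fintype.card_unit]
    have : k * (m * (0 + 0 + 1 + 1) + 1 + 1) = k * (2 * m + 2) := by ring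
    omega
  · rw [hrun]
    simp [labelCollisionTest, restrictAnswer, Answer.bits, pt, funext_iff]

/-! ### Means of `ℝ≥0∞`-valued functions -/

/-- The mean of `F` under `p`. -/
noncomputable def mean {α : Type*} (p : PMF α) (F : α → ℝ≥0∞) : ℝ≥0∞ := ∑' a, p a * F a

theorem mean_pure {α : Type*} (a : α) (F : α → ℝ≥0∞) : mean (PMF.pure a) F = F a := by
  rw [mean, tsum_eq_single a (fun b hb => by simp [PMF.pure_apply, hb])]
  simp

theorem mean_bind {α β : Type*} (p : PMF α) (q : α → PMF β) (F : β → ℝ≥0∞) :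
    mean (p.bind q) F = mean p fun a => mean (q a) F := by
  simp only [mean, PMF.bind_apply, ← ENNReal.tsum_mul_right, ← ENNReal.tsum_mul_left]
  rw [ENNReal.tsum_comm]
  simp only [mul_assoc]

theorem mean_map {α β : Type*} (p : PMF α) (h : α → β) (F : β → ℝ≥0∞) :
    mean (p.map h) F = mean p (F ∘ h) := by
  simp [PMF.map, mean_bind, mean_pure, Function.comp_def]

theorem mean_const {α : Type*} (p : PMF α) (c : ℝ≥0∞) : mean p (fun _ => c) = c := by
  rw [mean, ENNReal.tsum_mul_right, p.tsum_coe, one_mul]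

theorem mean_mono {α : Type*} (p : PMF α) {F G : α → ℝ≥0∞} (h : ∀ a, F a ≤ G a) :
    mean p F ≤ mean p G :=
  ENNReal.tsum_le_tsum fun a => mul_le_mul_right (h a) _

theorem mean_add {α : Type*} (p : PMF α) (F G : α → ℝ≥0∞) :
    mean p (fun a => F a + G a) = mean p F + mean p G := by
  simp only [mean, mul_add, ENNReal.tsum_add]

theorem mean_mul_right {α : Type*} (p : PMF α) (F : α → ℝ≥0∞) (c : ℝ≥0∞) :
    mean p (fun a => F a * c) = mean p F * c := by
  simp only [mean, ← mul_assoc, ENNReal.tsum_mul_right]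

theorem mean_mul_left {α : Type*} (p : PMF α) (F : α → ℝ≥0∞) (c : ℝ≥0∞) :
    mean p (fun a => c * F a) = c * mean p F := by
  simp only [mul_comm c, mean_mul_right]

theorem mean_sum {α β : Type*} (s : Finset β) (p : PMF α) (F : β → α → ℝ≥0∞) :
    mean p (fun a => ∑ b ∈ s, F b a) = ∑ b ∈ s, mean p (F b) := by
  simp only [mean, Finset.mul_sum]
  exact Summable.tsum_finsetSum fun _ _ => ENNReal.summable

theorem mean_iid_succ {α : Type} (p : PMF α) (m : ℕ) (F : (Fin (m + 1) → α) → ℝ≥0∞) :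
    mean (iid p (m + 1)) F = mean p fun a => mean (iid p m) fun v => F (Fin.cons a v) := by
  simp only [iid, mean_bind, mean_pure]

theorem mean_iid_map {α β : Type} (p : PMF α) (h : α → β) (m : ℕ) (F : (Fin m → β) → ℝ≥0∞) :
    mean (iid (p.map h) m) F = mean (iid p m) fun v => F fun i => h (v i) := by
  induction m with
  | zero =>
    simp only [iid, mean_pure]
    congr 1
    exact Subsingleton.elim _ _
  | succ m ih =>
    simp only [mean_iid_succ, mean_map, ih, Function.comp_def]
    congr! with a v i
    refine Fin.cases ?_ (fun j => ?_) i <;> simp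

theorem mean_uniform {α : Type*} [Fintype α] [Nonempty α] (F : α → ℝ≥0∞) :
    mean (PMF.uniformOfFintype α) F = (Fintype.card α : ℝ≥0∞)⁻¹ * ∑ a, F a := by
  simp [mean, Finset.mul_sum, tsum_fintype]

/-! ### Acceptance probability of the label and collision test -/

/-- The probability that a random labelled point has the label given by `f`. -/
noncomputable def labelProb {X : Type} (f : X → Bool) (p : PMF (X × Bool)) : ℝ≥0∞ :=
  mean p fun z => if z.2 = f z.1 then 1 else 0

/-- The probability that two independent random labelled points have distinct points. -/
noncomputable def distinctProb {X : Type} [DecidableEq X] (p : PMF (X × Bool)) : ℝ≥0∞ :=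
  mean p fun a => mean p fun b => if a.1 ≠ b.1 then 1 else 0

theorem mean_iid_distinct {X : Type} [DecidableEq X] (p : PMF (X × Bool)) (k : ℕ) :
    mean (iid p (2 * k)) (fun a => if ∀ i : Fin k, (a ⟨2 * i, by omega⟩).1 ≠
      (a ⟨2 * i + 1, by omega⟩).1 then 1 else 0) = distinctProb p ^ k := by
  induction k with
  | zero => simp [mean_const]
  | succ k ih =>
    have h (a b : X × Bool) (v : Fin (2 * k) → X × Bool) :
        (if ∀ i : Fin (k + 1), ((Fin.cons a (Fin.cons b v : Fin (2 * k + 1) → X × Bool) :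
            Fin (2 * k + 2) → X × Bool) ⟨2 * i, by omega⟩).1 ≠
          ((Fin.cons a (Fin.cons b v : Fin (2 * k + 1) → X × Bool) :
            Fin (2 * k + 2) → X × Bool) ⟨2 * i + 1, by omega⟩).1 then (1 : ℝ≥0∞) else 0) =
        (if a.1 ≠ b.1 then 1 else 0) * (if ∀ i : Fin k, (v ⟨2 * i, by omega⟩).1 ≠
          (v ⟨2 * i + 1, by omega⟩).1 then 1 else 0) := by
      rw [ite_zero_mul, one_mul, ← ite_and]
      exact if_congr Fin.forall_fin_succ rfl rfl
    calc _ = mean (iid p (2 * k + 1 + 1)) _ := rfl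
      _ = mean p fun a => mean p fun b => mean (iid p (2 * k)) fun v =>
          (if a.1 ≠ b.1 then 1 else 0) * (if ∀ i : Fin k, (v ⟨2 * i, by omega⟩).1 ≠
          (v ⟨2 * i + 1, by omega⟩).1 then 1 else 0) := by
        simp only [mean_iid_succ, ← h]
      _ = distinctProb p ^ (k + 1) := by
        simp only [mean_mul_left, mean_mul_right, ih, pow_succ', distinctProb]

/-- The label check and the pair checks read disjoint samples, hence are independent. Using fresh
pairs rather than all pairs is what makes this an exact product. -/
theorem mean_iid_labelCollisionTest {X : Type} [DecidableEq X] (f : X → Bool)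
    (p : PMF (X × Bool)) (k : ℕ) :
    mean (iid p (2 * k + 1)) (fun a => if labelCollisionTest f a = true then 1 else 0) =
      labelProb f p * distinctProb p ^ k := by
  have h (a : X × Bool) (v : Fin (2 * k) → X × Bool) :
      (if labelCollisionTest f (Fin.cons a v : Fin (2 * k + 1) → X × Bool) = true
        then (1 : ℝ≥0∞) else 0) =
      (if a.2 = f a.1 then 1 else 0) * (if ∀ i : Fin k, (v ⟨2 * i, by omega⟩).1 ≠
          (v ⟨2 * i + 1, by omega⟩).1 then 1 else 0) := by
    rw [ite_zero_mul, one_mul, ← ite_and, labelCollisionTest]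
    congr 1
    simp only [Bool.and_eq_true, beq_iff_eq, decide_eq_true_eq]
    rfl
  simp only [mean_iid_succ, h, mean_mul_left, mean_mul_right, mean_iid_distinct, labelProb]

theorem apply_eq_mean {α : Type*} [DecidableEq α] (p : PMF α) (b : α) :
    p b = mean p fun a => if a = b then 1 else 0 := by
  rw [mean, tsum_eq_single b (fun a ha => by simp [ha])]
  simp

/-- There is a distinguisher of size `O(2^m n)` that carries out the label and collision test. -/
theorem exists_distinguisher {m n : ℕ} (e : Fin m → Fin n) (f : Cube m → Bool) (k : ℕ) :
    ∃ D : Distinguisher n,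
      D.size ≤ (2 * k + 1) * (n + 1) + (4 * 2 ^ m + 1 + k * (2 * m + 2)) ∧
      ∀ B : Object Unit (Answer n), D.output B true =
        labelProb f ((B ()).map (restrictAnswer e)) *
          distinctProb ((B ()).map (restrictAnswer e)) ^ k := by
  obtain ⟨T, hT, hrun⟩ := exists_circuit_labelCollisionTest e f k
  refine ⟨⟨2 * k + 1, 0, T⟩, hT, fun B => ?_⟩
  rw [← mean_iid_labelCollisionTest, mean_iid_map, apply_eq_mean]
  simp only [Distinguisher.output, mean_bind, mean_map, Function.comp_def, hrun, mean_const]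

/-! ### A single object agrees with few functions -/

section SingleObject

variable {X : Type} [Fintype X]

theorem labelProb_eq_sum (f : X → Bool) (p : PMF (X × Bool)) :
    labelProb f p = ∑ x, p (x, f x) := by
  rw [labelProb, mean, tsum_fintype, Fintype.sum_prod_type]
  refine Finset.sum_congr rfl fun x _ => ?_
  simp

variable [DecidableEq X]

/-- The sum is the collision probability: the squared `ℓ²` norm of the marginal on points. -/
theorem distinctProb_add_sum (p : PMF (X × Bool)) :
    distinctProb p + ∑ x, (p (x, true) + p (x, false)) ^ 2 = 1 := by
  have h₁ : ∑ x, (p (x, true) + p (x, false)) ^ 2 =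
      mean p fun a => mean p fun b => if a.1 = b.1 then 1 else 0 := by
    simp only [mean, tsum_fintype, Fintype.sum_prod_type, Fintype.sum_bool, mul_ite, mul_one,
      mul_zero, Finset.sum_add_distrib, Finset.sum_ite_eq, Finset.mem_univ, if_true]
    rw [← Finset.sum_add_distrib]
    exact Finset.sum_congr rfl fun x _ => by ring
  rw [h₁, distinctProb, ← mean_add]
  simp only [← mean_add]
  calc _ = mean p fun _ => mean p fun _ => 1 := by
        congr! 4 with a b
        by_cases h : a.1 = b.1 <;> simp [h]
    _ = 1 := by simp only [mean_const]

/-- A uniformly random `f` is a family of independent fair signs, so the moment generating function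
factors over the points. -/
theorem sum_exp_signs (d : X → ℝ) :
    ∑ f : X → Bool, Real.exp (∑ x, if f x then d x else -d x) =
      2 ^ Fintype.card X * ∏ x, Real.cosh (d x) := by
  simp only [Real.exp_sum]
  have := Fintype.prod_sum (fun (x : X) (b : Bool) => Real.exp (if b then d x else -d x))
  rw [← this, ← Finset.card_univ, ← Finset.prod_const, ← Finset.prod_mul_distrib]
  refine Finset.prod_congr rfl fun x _ => ?_
  rw [Real.cosh_eq, Fintype.sum_bool]
  simp only [if_true, Bool.false_eq_true, if_false]
  ring

theorem sum_exp_signs_le (d : X → ℝ) :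
    ∑ f : X → Bool, Real.exp (∑ x, if f x then d x else -d x) ≤
      2 ^ Fintype.card X * Real.exp ((∑ x, d x ^ 2) / 2) := by
  rw [sum_exp_signs, Finset.sum_div, Real.exp_sum]
  refine mul_le_mul_of_nonneg_left ?_ (by positivity)
  exact Finset.prod_le_prod (fun _ _ => (Real.cosh_pos _).le) fun x _ => Real.cosh_le_exp_half_sq _

/-- Hoeffding's inequality for the number of functions that agree with a probability vector. -/
theorem card_agree_le (P : X × Bool → ℝ) (h0 : ∀ z, 0 ≤ P z) (h1 : ∑ z, P z = 1) {N : ℝ}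
    (hN : 0 < N) (hP : ∑ x, (P (x, true) + P (x, false)) ^ 2 ≤ 16 / N) :
    ((Finset.univ.filter fun f : X → Bool => 9 / 16 < ∑ x, P (x, f x)).card : ℝ) ≤
      2 ^ Fintype.card X * Real.exp (-N / 2048) := by
  -- The factor `N / 128` is the optimal Chernoff parameter: the signed sum of the label differences
  -- must exceed `1/8`, and its variance is at most `16 / N`.
  let d (x : X) : ℝ := N / 128 * (P (x, true) - P (x, false))
  have hd : ∑ x, d x ^ 2 ≤ N / 1024 := by
    calc ∑ x, d x ^ 2 ≤ ∑ x, (N / 128) ^ 2 * (P (x, true) + P (x, false)) ^ 2 := by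
          refine Finset.sum_le_sum fun x _ => ?_
          rw [mul_pow]
          refine mul_le_mul_of_nonneg_left ?_ (by positivity)
          nlinarith [mul_nonneg (h0 (x, true)) (h0 (x, false))]
      _ ≤ (N / 128) ^ 2 * (16 / N) := by
          rw [← Finset.mul_sum]
          exact mul_le_mul_of_nonneg_left hP (by positivity)
      _ = N / 1024 := by field_simp; norm_num
  have hs (f : X → Bool) :
      ∑ x, (if f x then d x else -d x) = N / 64 * (∑ x, P (x, f x) - 1 / 2) := by
    rw [← h1, Fintype.sum_prod_type, Finset.sum_div, ← Finset.sum_sub_distrib, Finset.mul_sum]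
    refine Finset.sum_congr rfl fun x _ => ?_
    rw [Fintype.sum_bool]
    cases f x <;> simp [d] <;> ring
  have key : ((Finset.univ.filter fun f : X → Bool => 9 / 16 < ∑ x, P (x, f x)).card : ℝ) *
      Real.exp (N / 1024) ≤ 2 ^ Fintype.card X * Real.exp (N / 2048) := by
    calc _ = ∑ f : X → Bool with 9 / 16 < ∑ x, P (x, f x), Real.exp (N / 1024) := by simp
      _ ≤ ∑ f : X → Bool with 9 / 16 < ∑ x, P (x, f x),
            Real.exp (∑ x, if f x then d x else -d x) := by
          refine Finset.sum_le_sum fun f hf => Real.exp_le_exp.2 ?_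
          rw [hs]
          have := (Finset.mem_filter.1 hf).2
          nlinarith
      _ ≤ ∑ f : X → Bool, Real.exp (∑ x, if f x then d x else -d x) :=
          Finset.sum_le_sum_of_subset_of_nonneg (Finset.filter_subset _ _)
            fun _ _ _ => (Real.exp_pos _).le
      _ ≤ _ := (sum_exp_signs_le d).trans
          (mul_le_mul_of_nonneg_left (Real.exp_le_exp.2 (by linarith)) (by positivity))
  rw [← le_div_iff₀ (Real.exp_pos _), mul_div_assoc, ← Real.exp_sub] at key
  rwa [show N / 2048 - N / 1024 = -N / 2048 by ring] at key

/-- For every object, only an exponentially small fraction of all functions `f` makes the test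
accept with probability more than `9/16`. -/
theorem card_accept_le (p : PMF (X × Bool)) {k : ℕ} (hk : 16 * k = Fintype.card X)
    (hX : 0 < Fintype.card X) :
    ((Finset.univ.filter fun f : X → Bool =>
      9 / 16 < labelProb f p * distinctProb p ^ k).card : ℝ) ≤
      2 ^ Fintype.card X * Real.exp (-(Fintype.card X : ℝ) / 2048) := by
  let P (z : X × Bool) : ℝ := (p z).toReal
  have hp (z) : p z = ENNReal.ofReal (P z) := (ENNReal.ofReal_toReal (p.apply_ne_top z)).symm
  have h0 (z) : 0 ≤ P z := ENNReal.toReal_nonneg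
  have h1 : ∑ z, P z = 1 := by
    have := p.tsum_coe
    rw [tsum_fintype] at this
    rw [← ENNReal.toReal_sum fun z _ => p.apply_ne_top z, this, ENNReal.toReal_one]
  have hN : (0 : ℝ) < Fintype.card X := by exact_mod_cast hX
  have hc : ∑ x, (p (x, true) + p (x, false)) ^ 2 =
      ENNReal.ofReal (∑ x, (P (x, true) + P (x, false)) ^ 2) := by
    rw [ENNReal.ofReal_sum_of_nonneg fun x _ => by positivity]
    refine Finset.sum_congr rfl fun x _ => ?_
    rw [ENNReal.ofReal_pow (add_nonneg (h0 _) (h0 _)), ENNReal.ofReal_add (h0 _) (h0 _), hp, hp]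
  have hl (f : X → Bool) : labelProb f p = ENNReal.ofReal (∑ x, P (x, f x)) := by
    rw [labelProb_eq_sum, ENNReal.ofReal_sum_of_nonneg fun x _ => h0 _]
    exact Finset.sum_congr rfl fun x _ => hp _
  have hdis := distinctProb_add_sum p
  have hd1 : distinctProb p ≤ 1 := hdis ▸ le_self_add
  have h916 : (9 / 16 : ℝ≥0∞) = ENNReal.ofReal (9 / 16) := by
    rw [ENNReal.ofReal_div_of_pos (by norm_num)]; norm_num
  -- Low collision probability: drop the collision factor and apply Hoeffding. High collision
  -- probability: drop the label factor, and no `f` at all is exceptional.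
  rcases le_total (∑ x, (P (x, true) + P (x, false)) ^ 2) (16 / Fintype.card X) with hP | hP
  · refine le_trans ?_ (card_agree_le P h0 h1 hN hP)
    refine Nat.cast_le.2 (Finset.card_le_card fun f => ?_)
    simp only [Finset.mem_filter, Finset.mem_univ, true_and]
    intro hf
    have := hf.trans_le (mul_le_of_le_one_right' (pow_le_one' hd1 k))
    rw [hl, h916] at this
    exact (ENNReal.ofReal_lt_ofReal_iff_of_nonneg (by norm_num)).1 this
  · have hle : (Finset.univ.filter fun f : X → Bool =>
        9 / 16 < labelProb f p * distinctProb p ^ k) = ∅ := by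
      refine Finset.filter_eq_empty_iff.2 fun f _ => not_lt.2 ?_
      have hlf : labelProb f p ≤ 1 := by
        rw [labelProb]
        refine (mean_mono p fun z => ?_).trans (mean_const p 1).le
        split_ifs <;> simp
      refine (mul_le_of_le_one_left' hlf).trans ?_
      have hd : distinctProb p ≤ ENNReal.ofReal (Real.exp (-(16 / Fintype.card X))) := by
        have : distinctProb p = 1 - ENNReal.ofReal (∑ x, (P (x, true) + P (x, false)) ^ 2) := by
          rw [← hc, ← hdis, ENNReal.add_sub_cancel_right]
          exact ne_top_of_le_ne_top ENNReal.one_ne_top (hdis ▸ le_add_self)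
        rw [this, ← ENNReal.ofReal_one,
          ← ENNReal.ofReal_sub _ (Finset.sum_nonneg fun x _ => by positivity)]
        refine ENNReal.ofReal_le_ofReal ?_
        have := Real.add_one_le_exp (-(16 / (Fintype.card X : ℝ)))
        linarith
      calc distinctProb p ^ k ≤ ENNReal.ofReal (Real.exp (-(16 / Fintype.card X))) ^ k := by
            gcongr
        _ = ENNReal.ofReal (Real.exp (-1)) := by
            rw [← ENNReal.ofReal_pow (Real.exp_pos _).le, ← Real.exp_nat_mul]
            congr 2
            have : (16 * k : ℝ) = Fintype.card X := by exact_mod_cast hk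
            field_simp
            linarith
        _ ≤ 9 / 16 := by
            rw [h916]
            refine ENNReal.ofReal_le_ofReal ?_
            have := Real.exp_neg_one_lt_d9
            norm_num at this ⊢
            linarith
    rw [hle]
    simp only [Finset.card_empty, Nat.cast_zero]
    positivity

end SingleObject

/-! ### From objects to models -/

open Classical in
-- Since `g ≤ 1`, it is at most `c` plus the indicator of `c < g`. A mean above `c + ε` thus forces
-- this indicator to have mean at least `ε`; summing over `f` and exchanging the sums leaves the
-- pointwise bound `δ`.
theorem card_mean_mul_le {α Φ : Type*} [Fintype Φ] (M : PMF α) {g : Φ → α → ℝ≥0∞}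
    (hg : ∀ f a, g f a ≤ 1) {c ε δ : ℝ≥0∞} (hc : c ≠ ∞)
    (h : ∀ a, ((Finset.univ.filter fun f => c < g f a).card : ℝ≥0∞) ≤ δ) :
    ((Finset.univ.filter fun f => c + ε < mean M (g f)).card : ℝ≥0∞) * ε ≤ δ := by
  let ind (f : Φ) (a : α) : ℝ≥0∞ := if c < g f a then 1 else 0
  have hmean (f : Φ) : mean M (g f) ≤ c + mean M (ind f) := by
    have hadd := mean_add M (fun _ => c) (ind f)
    rw [mean_const] at hadd
    rw [← hadd]
    refine mean_mono M fun a => ?_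
    by_cases hca : c < g f a
    · simpa [ind, hca] using (hg f a).trans le_add_self
    · simp only [ind, if_neg hca, add_zero]
      exact not_lt.1 hca
  calc _ = ∑ f : Φ with c + ε < mean M (g f), ε := by simp
    _ ≤ ∑ f : Φ with c + ε < mean M (g f), mean M (ind f) := by
        refine Finset.sum_le_sum fun f hf => ?_
        exact (ENNReal.add_le_add_iff_left hc).1 ((Finset.mem_filter.1 hf).2.le.trans (hmean f))
    _ ≤ ∑ f : Φ, mean M (ind f) := Finset.sum_le_univ_sum_of_nonneg fun _ => zero_le
    _ = mean M fun a => ∑ f, ind f a := (mean_sum _ _ _).symm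
    _ ≤ mean M fun _ => δ := mean_mono M fun a => by
        refine le_trans (le_of_eq ?_) (h a)
        simp [ind, Finset.sum_boole]
    _ = δ := mean_const M δ

open Classical in
theorem exists_forall_mean_le {α Φ : Type*} [Fintype Φ] (S : Finset (PMF α)) {g : Φ → α → ℝ≥0∞}
    (hg : ∀ f a, g f a ≤ 1) {c ε δ : ℝ≥0∞} (hc : c ≠ ∞)
    (h : ∀ a, ((Finset.univ.filter fun f => c < g f a).card : ℝ≥0∞) ≤ δ)
    (hS : S.card * δ < Fintype.card Φ * ε) :
    ∃ f, ∀ M ∈ S, mean M (g f) ≤ c + ε := by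
  by_contra! hcon
  have hcov : (Finset.univ : Finset Φ) ⊆
      S.biUnion fun M => Finset.univ.filter fun f => c + ε < mean M (g f) := fun f _ => by
    obtain ⟨M, hM, hf⟩ := hcon f
    exact Finset.mem_biUnion.2 ⟨M, hM, Finset.mem_filter.2 ⟨Finset.mem_univ _, hf⟩⟩
  have h₁ := (Finset.card_le_card hcov).trans Finset.card_biUnion_le
  rw [Finset.card_univ] at h₁
  have h₂ : (Fintype.card Φ : ℝ≥0∞) * ε ≤ S.card * δ :=
    calc (Fintype.card Φ : ℝ≥0∞) * ε
        ≤ (∑ M ∈ S, (Finset.univ.filter fun f => c + ε < mean M (g f)).card : ℕ) * ε := by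
          gcongr
      _ = ∑ M ∈ S, ((Finset.univ.filter fun f => c + ε < mean M (g f)).card : ℝ≥0∞) * ε := by
          rw [Nat.cast_sum, Finset.sum_mul]
      _ ≤ ∑ M ∈ S, δ := Finset.sum_le_sum fun M _ => card_mean_mul_le M hg hc h
      _ = S.card * δ := by simp
  exact absurd hS h₂.not_gt

/-! ### The law of a model is determined by its implementation -/

theorem Program.measurable_eval {ι : Type} (x : ι → Bool) {g : ℕ} (P : Program Unit ι g)
    (v : ι ⊕ Fin g) : Measurable fun r : List Bool → Bool => P.eval (fun _ => r) x v := by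
  induction P with
  | nil =>
    cases v with
    | inl i => exact measurable_const
    | inr i => exact i.elim0
  | @snoc g P γ ih =>
    cases v with
    | inl i => exact measurable_const
    | inr i =>
      refine Fin.lastCases ?_ (fun j => ?_) i
      · simp only [Program.eval_snoc_last]
        cases γ with
        | const b => exact measurable_const
        | binop op i j =>
          exact (Measurable.of_discrete (f := fun b : Bool × Bool => op b.1 b.2)).comp
            ((ih i).prodMk (ih j))
        | query o args =>
          -- The queried string itself depends on the oracle, so the event is split over the
          -- countably many possible strings.
          let q (r : List Bool → Bool) : List Bool := args.map (P.eval (fun _ => r) x)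
          have hq (l : List Bool) : MeasurableSet {r | q r = l} := by
            -- The default `false` of `getD` is immaterial: it could be read only when the lengths
            -- differ, and then the first set is empty.
            have : {r | q r = l} = {r | args.length = l.length} ∩
                ⋂ i : Fin args.length, {r | P.eval (fun _ => r) x args[i] = l.getD i false} := by
              ext r
              simp only [q, Set.mem_ofPred_eq, Set.mem_inter_iff, Set.mem_iInter]
              constructor
              · rintro rfl
                simp
              · rintro ⟨h₁, h₂⟩
                refine List.ext_getElem (by simpa using h₁) fun i hi hi' => ?_
                have := h₂ ⟨i, by simpa using hi⟩
                simpa [hi'] using this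
            rw [this]
            refine MeasurableSet.inter (MeasurableSet.const _) (MeasurableSet.iInter fun i => ?_)
            exact ih _ (measurableSet_singleton _)
          refine measurable_to_countable' fun b => ?_
          have : (fun r : List Bool → Bool => Gate.eval (fun _ => r) (P.eval (fun _ => r) x)
              (.query o args)) ⁻¹' {b} = ⋃ l : List Bool, {r | q r = l} ∩ {r | r l = b} := by
            ext r
            simp [Gate.eval, q]
          rw [this]
          refine MeasurableSet.iUnion fun l => (hq l).inter ?_
          exact measurableSet_eq_fun (measurable_pi_apply l) measurable_const
      · have h (r : List Bool → Bool) : (P.snoc γ).eval (fun _ => r) x (.inr j.castSucc) =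
            P.eval (fun _ => r) x (.inr j) := P.eval_snoc_castSucc _ x γ (.inr j)
        simpa only [h] using ih (Sum.inr j)

theorem Circuit.measurable_eval {ι β : Type} (T : Circuit Unit ι β) :
    Measurable fun (r : List Bool → Bool) (x : ι → Bool) => T.eval (fun _ => r) x :=
  measurable_pi_lambda _ fun x => measurable_pi_lambda _ fun b =>
    T.program.measurable_eval x (T.out b)

/-- If a random variable has the discrete law `M`, then its image under `h` has the law `M.map h`. -/
theorem measure_eq_map {Ω α β : Type*} [MeasurableSpace Ω] (μ : Measure Ω) [IsProbabilityMeasure μ]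
    {B : Ω → α} {M : PMF α} (hB : ∀ a, MeasurableSet {ω | B ω = a})
    (hM : ∀ a, μ {ω | B ω = a} = M a) (h : α → β) (b : β) :
    μ {ω | h (B ω) = b} = M.map h b := by
  classical
  have hS (S : Set α) : μ {ω | B ω ∈ M.support ∩ S} = ∑' a : ↥(M.support ∩ S), M a := by
    have hc : (M.support ∩ S).Countable := M.support_countable.mono Set.inter_subset_left
    have := hc.to_subtype
    have hu : {ω | B ω ∈ M.support ∩ S} = ⋃ a : ↥(M.support ∩ S), {ω | B ω = a} := by
      ext ω; simp
    have hdisj : Pairwise (Function.onFun Disjoint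
        fun a : ↥(M.support ∩ S) => {ω | B ω = a}) := fun a a' haa =>
      Set.disjoint_left.2 fun ω (h₁ : B ω = a) (h₂ : B ω = a') =>
        haa (Subtype.ext (h₁.symm.trans h₂))
    rw [hu, measure_iUnion hdisj fun a => hB a]
    exact tsum_congr fun a => hM a
  have hmeas : MeasurableSet {ω | B ω ∈ M.support} := by
    have hu : {ω | B ω ∈ M.support} = ⋃ a ∈ M.support, {ω | B ω = a} := by ext ω; simp
    rw [hu]
    exact MeasurableSet.biUnion M.support_countable fun a _ => hB a
  -- The space of values may be uncountable, but the point masses of `M` sum to `1` on its countable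
  -- support, so almost every value of `B` lies there and countable additivity suffices.
  have hfull : μ {ω | B ω ∈ M.support}ᶜ = 0 := by
    rw [prob_compl_eq_zero_iff hmeas]
    have := hS Set.univ
    rw [tsum_subtype (M.support ∩ Set.univ) (fun a => M a)] at this
    simp only [Set.inter_univ] at this
    rw [this]
    have hind : M.support.indicator (fun a => M a) = fun a => M a :=
      Set.indicator_eq_self.2 fun a ha => ha
    rw [hind, M.tsum_coe]
  have h₁ : μ {ω | h (B ω) = b} = μ {ω | B ω ∈ M.support ∩ {a | h a = b}} := by
    refine measure_congr ?_
    filter_upwards [mem_ae_iff.2 hfull] with ω hω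
    exact propext ⟨fun hb => ⟨hω, hb⟩, fun hb => hb.2⟩
  rw [h₁, hS, tsum_subtype (M.support ∩ {a | h a = b}) (fun a => M a), PMF.map_apply]
  refine tsum_congr fun a => ?_
  by_cases ha : h a = b
  · by_cases hs : M a = 0
    · simp [hs]
    · simp [Set.indicator, ha, hs]
  · have : b ≠ h a := fun hb => ha hb.symm
    simp [ha, this]

/-! ### Counting circuits -/

section Counting

variable {κ ι ν β : Type}

/-- Grouping lists by length gives a geometric series of ratio at most `1/2`. This handles oracle
gates of unbounded arity. -/
theorem tsum_list_pow_le [Fintype ν] {q : ℝ≥0∞} (hq : Fintype.card ν * q ≤ 1 / 2) :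
    ∑' l : List ν, q ^ (l.length + 1) ≤ 2 * q := by
  let F : (Σ n : ℕ, Fin n → ν) → List ν := fun p => List.ofFn p.2
  have hF : F.Surjective := fun l => ⟨⟨l.length, l.get⟩, List.ofFn_get l⟩
  calc ∑' l : List ν, q ^ (l.length + 1)
      ≤ ∑' p : (Σ n : ℕ, Fin n → ν), q ^ ((F p).length + 1) :=
        ENNReal.tsum_le_tsum_comp_of_surjective hF _
    _ = ∑' n : ℕ, q * (Fintype.card ν * q) ^ n := by
        rw [ENNReal.tsum_sigma']
        refine tsum_congr fun n => ?_
        simp only [F, List.length_ofFn, tsum_fintype, Finset.sum_const, Finset.card_univ,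
          Fintype.card_fun, Fintype.card_fin, nsmul_eq_mul, Nat.cast_pow, mul_pow, pow_succ]
        ring
    _ = q * (1 - Fintype.card ν * q)⁻¹ := by rw [ENNReal.tsum_mul_left, ENNReal.tsum_geometric]
    _ ≤ q * 2 := by
        refine mul_le_mul_right ?_ q
        rw [ENNReal.inv_le_iff_inv_le]
        refine le_trans ?_ (tsub_le_tsub_left hq 1)
        simp
    _ = 2 * q := mul_comm _ _

/-- The weight of a single gate or node in the enumeration of programs of cost at most `W`. -/
noncomputable def gateWeight (W : ℕ) : ℝ≥0∞ := ((20 * W ^ 2 : ℕ) : ℝ≥0∞)⁻¹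

theorem gateWeight_mul {W : ℕ} (hW : 0 < W) : ((20 * W ^ 2 : ℕ) : ℝ≥0∞) * gateWeight W = 1 :=
  ENNReal.mul_inv_cancel (by positivity) (ENNReal.natCast_ne_top _)

/-- A Kraft-type inequality. Constants contribute `2 q`, the sixteen binary operations at most `16
W² q`, and queries at most `2 q`; this is where the `20 W²` in `gateWeight` comes from. -/
theorem tsum_gate_le [Fintype ν] [Fintype κ] (hκ : Fintype.card κ ≤ 1) {W : ℕ} (hW : 0 < W)
    (hν : Fintype.card ν ≤ W) : ∑' γ : Gate κ ν, gateWeight W ^ γ.cost ≤ 1 := by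
  set q := gateWeight W with hq
  let F : Bool ⊕ ((Bool → Bool → Bool) × ν × ν) ⊕ κ × List ν → Gate κ ν
    | .inl b => .const b
    | .inr (.inl (op, i, j)) => .binop op i j
    | .inr (.inr (o, l)) => .query o l
  have hF : F.Surjective := by
    rintro (b | ⟨op, i, j⟩ | ⟨o, l⟩)
    exacts [⟨.inl b, rfl⟩, ⟨.inr (.inl (op, i, j)), rfl⟩, ⟨.inr (.inr (o, l)), rfl⟩]
  have hνq : Fintype.card ν * q ≤ 1 / 2 := by
    rw [ENNReal.le_div_iff_mul_le (by simp) (by simp), ← gateWeight_mul hW, mul_right_comm]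
    gcongr
    calc (Fintype.card ν : ℝ≥0∞) * 2 = ((Fintype.card ν * 2 : ℕ) : ℝ≥0∞) := by push_cast; rfl
      _ ≤ _ := Nat.cast_le.2 (by nlinarith)
  calc ∑' γ : Gate κ ν, q ^ γ.cost ≤ ∑' x, q ^ (F x).cost :=
        ENNReal.tsum_le_tsum_comp_of_surjective hF _
    _ = 2 * q + (16 * (Fintype.card ν * Fintype.card ν) * q +
          Fintype.card κ * ∑' l : List ν, q ^ (l.length + 1)) := by
        rw [ENNReal.summable.tsum_sum ENNReal.summable, ENNReal.summable.tsum_sum ENNReal.summable]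
        simp only [F, Gate.cost, tsum_fintype, pow_one, Finset.sum_const, Finset.card_univ,
          Fintype.card_bool, Fintype.card_prod, Fintype.card_fun, nsmul_eq_mul]
        rw [ENNReal.tsum_prod (f := fun (_ : κ) (l : List ν) => q ^ (l.length + 1)), tsum_fintype]
        simp only [Finset.sum_const, Finset.card_univ, nsmul_eq_mul]
        norm_num
    _ ≤ 2 * q + (16 * (W * W) * q + 1 * (2 * q)) := by
        gcongr
        · exact_mod_cast hκ
        · exact tsum_list_pow_le hνq
    _ = ((4 + 16 * (W * W) : ℕ) : ℝ≥0∞) * q := by push_cast; ring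
    _ ≤ ((20 * W ^ 2 : ℕ) : ℝ≥0∞) * q := by
        gcongr
        nlinarith
    _ = 1 := gateWeight_mul hW

theorem tsum_program_le [Fintype ι] [Fintype κ] (hκ : Fintype.card κ ≤ 1) {W : ℕ} (hW : 0 < W)
    {g : ℕ} (hg : Fintype.card ι + g ≤ W) :
    ∑' P : Program κ ι g, gateWeight W ^ P.cost ≤ 1 := by
  induction g with
  | zero =>
    have h (P : Program κ ι 0) : P = .nil := by cases P; rfl
    rw [tsum_eq_single Program.nil fun P hP => absurd (h P) hP]
    simp [Program.cost]
  | succ g ih =>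
    let F : Program κ ι g × Gate κ (ι ⊕ Fin g) → Program κ ι (g + 1) := fun p => p.1.snoc p.2
    have hF : F.Surjective := by
      intro P
      cases P with
      | snoc P γ => exact ⟨(P, γ), rfl⟩
    calc _ ≤ ∑' p, gateWeight W ^ (F p).cost := ENNReal.tsum_le_tsum_comp_of_surjective hF _
      _ = ∑' P : Program κ ι g, gateWeight W ^ P.cost *
            ∑' γ : Gate κ (ι ⊕ Fin g), gateWeight W ^ γ.cost := by
          rw [ENNReal.tsum_prod']
          simp only [F, Program.cost, pow_add, ENNReal.tsum_mul_left]
      _ ≤ ∑' P : Program κ ι g, gateWeight W ^ P.cost * 1 := by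
          refine ENNReal.tsum_le_tsum fun P => mul_le_mul_right ?_ _
          exact tsum_gate_le hκ hW (by simp only [Fintype.card_sum, Fintype.card_fin]; omega)
      _ ≤ 1 := by simpa using ih (by omega)

/-- Each program counted has weight at least `gateWeight W ^ W`, while the total weight is at most
`1`. -/
theorem finite_program_cost_le [Fintype ι] [Fintype κ] (hκ : Fintype.card κ ≤ 1) {W : ℕ}
    (hW : 0 < W) {g : ℕ} (hg : Fintype.card ι + g ≤ W) :
    Finite {P : Program κ ι g // P.cost ≤ W} ∧
      Nat.card {P : Program κ ι g // P.cost ≤ W} ≤ (20 * W ^ 2) ^ W := by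
  have hq1 : gateWeight W ≤ 1 := by
    rw [gateWeight, ENNReal.inv_le_one]
    exact_mod_cast (by nlinarith : 1 ≤ 20 * W ^ 2)
  have hq0 : gateWeight W ^ W ≠ 0 :=
    pow_ne_zero _ (ENNReal.inv_ne_zero.2 (ENNReal.natCast_ne_top _))
  obtain ⟨hfin, hcard⟩ := ENNReal.finset_card_const_le_le_of_tsum_le ENNReal.one_ne_top
    (tsum_program_le hκ hW hg) hq0
  have hsub : {P : Program κ ι g | P.cost ≤ W} ⊆
      {P : Program κ ι g | gateWeight W ^ W ≤ gateWeight W ^ P.cost} := fun P hP =>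
    pow_le_pow_right_of_le_one' hq1 hP
  have hfin' := hfin.subset hsub
  refine ⟨hfin'.to_subtype, ?_⟩
  have h₁ : Nat.card {P : Program κ ι g // P.cost ≤ W} ≤ hfin.toFinset.card := by
    rw [← Set.ncard_eq_toFinset_card _ hfin]
    exact Set.ncard_le_ncard hsub hfin
  refine h₁.trans ?_
  have hinv : 1 / gateWeight W ^ W = (((20 * W ^ 2) ^ W : ℕ) : ℝ≥0∞) := by
    rw [one_div, gateWeight, ← ENNReal.inv_pow, inv_inv, Nat.cast_pow]
  rw [hinv] at hcard
  exact_mod_cast hcard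

theorem Program.le_cost {g : ℕ} (P : Program κ ι g) : g ≤ P.cost := by
  induction P with
  | nil => exact le_rfl
  | snoc P γ ih =>
    have : 1 ≤ γ.cost := by cases γ <;> simp [Gate.cost]
    simp only [Program.cost]; omega

theorem finite_circuit_size_le [Fintype ι] [Fintype κ] [Fintype β] (hκ : Fintype.card κ ≤ 1)
    {W : ℕ} (hW : 0 < W) :
    Finite {T : Circuit κ ι β // T.size ≤ W} ∧
      Nat.card {T : Circuit κ ι β // T.size ≤ W} ≤
        (W + 1) * ((20 * W ^ 2) ^ W * W ^ Fintype.card β) := by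
  classical
  let Fib (g : Fin (W + 1)) : Type :=
    {P : Program κ ι g // Fintype.card ι + P.cost ≤ W} × (β → ι ⊕ Fin g)
  have hFib (g : Fin (W + 1)) :
      Finite (Fib g) ∧ Nat.card (Fib g) ≤ (20 * W ^ 2) ^ W * W ^ Fintype.card β := by
    by_cases hg : Fintype.card ι + g ≤ W
    · obtain ⟨hf, hc⟩ := finite_program_cost_le (ι := ι) hκ hW hg
      let J : {P : Program κ ι g // Fintype.card ι + P.cost ≤ W} →
          {P : Program κ ι g // P.cost ≤ W} := fun P => ⟨P.1, by have := P.2; omega⟩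
      have hJ : J.Injective := fun P P' h => Subtype.ext (congrArg (fun Q => Q.1) h)
      have := Finite.of_injective J hJ
      refine ⟨inferInstanceAs (Finite (_ × _)), ?_⟩
      rw [Nat.card_prod]
      refine Nat.mul_le_mul ((Nat.card_le_card_of_injective J hJ).trans hc) ?_
      rw [Nat.card_eq_fintype_card, Fintype.card_fun]
      gcongr
      simpa using hg
    · have : IsEmpty (Fib g) := ⟨fun p => hg (by have := p.1.2; have := p.1.1.le_cost; omega)⟩
      exact ⟨inferInstance, by simp⟩
  have := fun g => (hFib g).1
  let J : {T : Circuit κ ι β // T.size ≤ W} → Σ g, Fib g := fun T =>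
    ⟨⟨T.1.gateCount, Nat.lt_succ_of_le (T.1.program.le_cost.trans
      ((Nat.le_add_left _ _).trans T.2))⟩, ⟨⟨T.1.program, T.2⟩, T.1.out⟩⟩
  have hJ : J.Injective := by
    rintro ⟨⟨g, P, o⟩, h⟩ ⟨⟨g', P', o'⟩, h'⟩ heq
    obtain rfl : g = g' := congrArg (fun x => (x.1 : ℕ)) heq
    have := eq_of_heq (Sigma.mk.inj heq).2
    obtain ⟨h₁, rfl⟩ := Prod.mk.inj this
    obtain rfl := congrArg Subtype.val h₁
    rfl
  refine ⟨Finite.of_injective J hJ, (Nat.card_le_card_of_injective J hJ).trans ?_⟩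
  rw [Nat.card_sigma]
  refine (Finset.sum_le_sum fun g _ => (hFib g).2).trans ?_
  simp

end Counting

/-! ### Counting projected models -/

/-- A circuit with only some of the output bits (or with repeated output bits). -/
def Circuit.restrict {κ ι β β' : Type} (T : Circuit κ ι β) (h : β' → β) : Circuit κ ι β' :=
  ⟨T.gateCount, T.program, fun b => T.out (h b)⟩

/-- The law of the restriction of the object to some bits of the point. -/
noncomputable def restrictModel {m n : ℕ} (e : Fin m → Fin n) (M : Model Unit (Answer n)) :
    PMF (PMF (Answer m)) :=
  M.map fun B => (B ()).map (restrictAnswer e)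

theorem IsOrdinaryImplementation.restrictModel_eq {m n ℓ t : ℕ} (e : Fin m → Fin n)
    {T : Circuit Empty (Fin ℓ ⊕ Fin t) (AnswerBit n)} {M : Model Unit (Answer n)}
    (h : IsOrdinaryImplementation T M) :
    restrictModel e M = (PMF.uniformOfFintype (Cube ℓ)).map fun r =>
      (PMF.uniformOfFintype (Cube t)).map fun s =>
        Answer.ofBits ((T.restrict (Sum.map e id)).run (Sum.elim r s)) := by
  obtain ⟨B, hB, rfl⟩ := h
  rw [restrictModel, PMF.map_comp]
  congr 1
  ext1 r
  simp only [Function.comp_apply]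
  rw [← hB, PMF.map_comp]
  rfl

instance : IsProbabilityMeasure randomOracle := by
  unfold randomOracle
  infer_instance

theorem IsRandomOracleImplementation.restrictModel_apply {m n t : ℕ} (e : Fin m → Fin n)
    {T : Circuit Unit (Fin t) (AnswerBit n)} {M : Model Unit (Answer n)}
    (h : IsRandomOracleImplementation T M) (P : PMF (Answer m)) :
    restrictModel e M P = randomOracle {r | ((PMF.uniformOfFintype (Cube t)).map fun s =>
      Answer.ofBits ((T.restrict (Sum.map e id)).eval (fun _ => r) s)) = P} := by
  obtain ⟨B, hB, hM⟩ := h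
  have hmeas (B₀ : Object Unit (Answer n)) : MeasurableSet {r | B r = B₀} := by
    let G (E : Cube t → AnswerBit n → Bool) : Object Unit (Answer n) := fun _ =>
      (PMF.uniformOfFintype (Cube t)).map fun s => Answer.ofBits (E s)
    have : B = fun r => G fun s => T.eval (fun _ => r) s := by
      ext1 r; ext1 q; exact (hB r q).symm
    have hset : {r | B r = B₀} =
        (fun r (s : Cube t) => T.eval (fun _ => r) s) ⁻¹' {E | G E = B₀} := by
      rw [this]; rfl
    rw [hset]
    -- The object depends on the oracle only through the truth table of `T`, an element of a finite
    -- space in which every set is measurable.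
    exact T.measurable_eval (Set.toFinite _).measurableSet
  rw [restrictModel, ← measure_eq_map randomOracle hmeas hM]
  congr 1
  ext r
  simp only [Set.mem_ofPred_eq, ← hB, PMF.map_comp]
  rfl

/-- There are only `2 ^ O(W log W)` projections of models of circuit complexity at most `W`. -/
theorem finite_restrictModel {m n : ℕ} (e : Fin m → Fin n) {W : ℕ} (hW : 0 < W) :
    Set.Finite {M' | ∃ M, ModelComplexityLE M W ∧ restrictModel e M = M'} ∧
      Set.ncard {M' | ∃ M, ModelComplexityLE M W ∧ restrictModel e M = M'} ≤
        2 * (W + 1) ^ 3 * ((20 * W ^ 2) ^ W * W ^ (m + 1)) := by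
  let Ord (p : Fin (W + 1) × Fin (W + 1)) : Type :=
    {T : Circuit Empty (Fin p.1 ⊕ Fin p.2) (AnswerBit m) // T.size ≤ W}
  let RO (t : Fin (W + 1)) : Type := {T : Circuit Unit (Fin t) (AnswerBit m) // T.size ≤ W}
  have hOrd (p : Fin (W + 1) × Fin (W + 1)) := finite_circuit_size_le (κ := Empty) (ι := Fin p.1 ⊕ Fin p.2) (β := AnswerBit m)
    (by simp) hW
  have hRO (t : Fin (W + 1)) := finite_circuit_size_le (κ := Unit) (ι := Fin t) (β := AnswerBit m) (by simp) hW
  have hcard : Fintype.card (AnswerBit m) = m + 1 := by simp [AnswerBit]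
  rw [hcard] at hOrd hRO
  have : ∀ p, Finite (Ord p) := fun p => (hOrd p).1
  have : ∀ t, Finite (RO t) := fun t => (hRO t).1
  -- A relation rather than a function: each circuit determines at most one law, which is enough to
  -- inject laws into circuits without first showing that every oracle circuit induces a `PMF`.
  let R : (Σ p, Ord p) ⊕ (Σ t, RO t) → PMF (PMF (Answer m)) → Prop
    | .inl ⟨p, T⟩, M' => M' = (PMF.uniformOfFintype (Cube p.1)).map fun r =>
        (PMF.uniformOfFintype (Cube p.2)).map fun s => Answer.ofBits (T.1.run (Sum.elim r s))
    | .inr ⟨t, T⟩, M' => ∀ P, M' P = randomOracle {r |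
        ((PMF.uniformOfFintype (Cube t)).map fun s =>
          Answer.ofBits (T.1.eval (fun _ => r) s)) = P}
  have hR (j) (M₁ M₂) (h₁ : R j M₁) (h₂ : R j M₂) : M₁ = M₂ := by
    rcases j with ⟨p, T⟩ | ⟨t, T⟩
    · exact h₁.trans h₂.symm
    · exact PMF.ext fun P => (h₁ P).trans (h₂ P).symm
  have hex (M' : {M' | ∃ M, ModelComplexityLE M W ∧ restrictModel e M = M'}) :
      ∃ j, R j M'.1 := by
    obtain ⟨_, M, h | h, rfl⟩ := M'
    · obtain ⟨ℓ, t, T, hT, hs⟩ := h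
      have hle : ℓ + t ≤ W := by
        have : Fintype.card (Fin ℓ ⊕ Fin t) ≤ W := (Nat.le_add_right _ _).trans hs
        simpa using this
      exact ⟨.inl ⟨(⟨ℓ, by omega⟩, ⟨t, by omega⟩), ⟨T.restrict (Sum.map e id), hs⟩⟩,
        hT.restrictModel_eq e⟩
    · obtain ⟨t, T, hT, hs⟩ := h
      have hle : t ≤ W := by
        have : Fintype.card (Fin t) ≤ W := (Nat.le_add_right _ _).trans hs
        simpa using this
      exact ⟨.inr ⟨⟨t, by omega⟩, ⟨T.restrict (Sum.map e id), hs⟩⟩, hT.restrictModel_apply e⟩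
  choose J hJ using hex
  have hinj : J.Injective := fun M₁ M₂ h => Subtype.ext (hR _ _ _ (hJ M₁) (h ▸ hJ M₂))
  have := Finite.of_injective J hinj
  refine ⟨Set.toFinite _, ?_⟩
  refine (Nat.card_le_card_of_injective J hinj).trans ?_
  rw [Nat.card_sum, Nat.card_sigma, Nat.card_sigma]
  have h₁ := Finset.sum_le_sum fun p (_ : p ∈ Finset.univ) => (hOrd p).2
  have h₂ := Finset.sum_le_sum fun t (_ : t ∈ Finset.univ) => (hRO t).2
  refine (add_le_add h₁ h₂).trans ?_
  simp only [Finset.sum_const, Finset.card_univ, Fintype.card_prod, Fintype.card_fin, smul_eq_mul]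
  set Y := (20 * W ^ 2) ^ W * W ^ (m + 1)
  calc _ = (W + 1) ^ 3 * Y + (W + 1) ^ 2 * Y := by ring
    _ ≤ (W + 1) ^ 3 * Y + (W + 1) ^ 3 * Y := by
        gcongr <;> omega
    _ = _ := by ring

/-! ### The honest object -/

theorem uniform_map_castAdd (m j : ℕ) :
    (PMF.uniformOfFintype (Cube (m + j))).map (fun x i => x (Fin.castAdd j i)) =
      PMF.uniformOfFintype (Cube m) := by
  classical
  refine PMF.ext fun b => ?_
  rw [apply_eq_mean, mean_map, mean_uniform, ← (Fin.appendEquiv m j).sum_comp,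
    Fintype.sum_prod_type]
  simp only [Function.comp_def, Fin.appendEquiv, Equiv.coe_fn_mk, Fin.append_left,
    Finset.sum_const, Finset.card_univ, Fintype.card_pi_const, Fintype.card_bool, nsmul_eq_mul,
    mul_ite, mul_one, mul_zero, Finset.sum_ite_eq', Finset.mem_univ, if_true,
    PMF.uniformOfFintype_apply, Nat.cast_pow, Nat.cast_ofNat, pow_add]
  push_cast
  rw [ENNReal.mul_inv (by simp) (by simp), mul_assoc, ENNReal.inv_mul_cancel (by simp) (by simp),
    mul_one]

theorem sampleAccess_map_restrictAnswer {m j : ℕ} (f : Cube m → Bool) :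
    (sampleAccess (fun x : Cube (m + j) => f fun i => x (Fin.castAdd j i)) ()).map
        (restrictAnswer (Fin.castAdd j)) =
      (PMF.uniformOfFintype (Cube m)).map fun u => (u, f u) := by
  rw [← uniform_map_castAdd m j, PMF.map_comp, sampleAccess, PMF.map_comp]
  rfl

section Honest

variable {X : Type} [Fintype X] [Nonempty X] (f : X → Bool)

theorem labelProb_graph :
    labelProb f ((PMF.uniformOfFintype X).map fun u => (u, f u)) = 1 := by
  simp [labelProb, mean_map, Function.comp_def, mean_const]

variable [DecidableEq X]

theorem distinctProb_graph :
    (distinctProb ((PMF.uniformOfFintype X).map fun u => (u, f u))).toReal =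
      1 - (Fintype.card X : ℝ)⁻¹ := by
  have hN : (Fintype.card X : ℝ≥0∞) ≠ 0 := by simp
  have h := distinctProb_add_sum ((PMF.uniformOfFintype X).map fun u => (u, f u))
  have hp (x : X) : ((PMF.uniformOfFintype X).map fun u => (u, f u)) (x, true) +
      ((PMF.uniformOfFintype X).map fun u => (u, f u)) (x, false) =
        (Fintype.card X : ℝ≥0∞)⁻¹ := by
    rw [apply_eq_mean, apply_eq_mean, ← mean_add, mean_map, mean_uniform,
      Finset.sum_eq_single x]
    · rcases hfx : f x <;> simp [hfx]
    · intro b _ hb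
      simp [hb]
    · simp
  simp only [hp, Finset.sum_const, Finset.card_univ, nsmul_eq_mul] at h
  rw [sq, ← mul_assoc, ENNReal.mul_inv_cancel hN (ENNReal.natCast_ne_top _), one_mul] at h
  have h' := congrArg ENNReal.toReal h
  have hinv : (Fintype.card X : ℝ≥0∞)⁻¹ ≠ ∞ := ENNReal.inv_ne_top.2 hN
  rw [ENNReal.toReal_add (ne_top_of_le_ne_top ENNReal.one_ne_top (h ▸ le_self_add)) hinv,
    ENNReal.toReal_inv, ENNReal.toReal_natCast, ENNReal.toReal_one] at h'
  linarith

theorem accept_graph_ge {k : ℕ} (hk : 16 * k = Fintype.card X) :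
    15 / 16 ≤ (labelProb f ((PMF.uniformOfFintype X).map fun u => (u, f u)) *
      distinctProb ((PMF.uniformOfFintype X).map fun u => (u, f u)) ^ k).toReal := by
  rw [labelProb_graph, one_mul, ENNReal.toReal_pow, distinctProb_graph]
  have hN : (0 : ℝ) < Fintype.card X := by exact_mod_cast Fintype.card_pos
  have hk' : (16 * k : ℝ) = Fintype.card X := by exact_mod_cast hk
  have h1 : (Fintype.card X : ℝ)⁻¹ ≤ 1 := by
    exact inv_le_one_of_one_le₀ (by exact_mod_cast Fintype.card_pos (α := X))
  -- Bernoulli's inequality, with `k / N = 1 / 16`.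
  have h := one_add_mul_le_pow (a := -(Fintype.card X : ℝ)⁻¹) (by linarith) k
  have : (k : ℝ) * -(Fintype.card X : ℝ)⁻¹ = -(1 / 16) := by
    rw [← hk'] at hN ⊢
    have : (k : ℝ) ≠ 0 := fun h => by simp [h] at hN
    field_simp
  rw [this] at h
  calc (15 / 16 : ℝ) = 1 + -(1 / 16) := by norm_num
    _ ≤ _ := h
    _ = _ := by ring

end Honest

/-! ### Numerical estimates -/

theorem model_count_le {W L m : ℕ} (hL : 1 ≤ L) (hLW : L ≤ W) (hW : W ≤ 2 ^ L)
    (hm : m ≤ 17 + 2 * L) :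
    2 * (W + 1) ^ 3 * ((20 * W ^ 2) ^ W * W ^ (m + 1)) ≤ 2 ^ (34 * (L * W)) := by
  have h1 : W + 1 ≤ 2 ^ (L + 1) := by
    have := Nat.one_le_two_pow (n := L)
    rw [pow_succ]; omega
  have h2 : 20 * W ^ 2 ≤ 2 ^ (5 + 2 * L) := by
    calc 20 * W ^ 2 ≤ 2 ^ 5 * (2 ^ L) ^ 2 := by gcongr; norm_num
      _ = 2 ^ (5 + 2 * L) := by ring
  calc _ ≤ 2 * (2 ^ (L + 1)) ^ 3 * ((2 ^ (5 + 2 * L)) ^ W * (2 ^ L) ^ (m + 1)) := by gcongr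
    _ = 2 ^ (1 + (L + 1) * 3 + ((5 + 2 * L) * W + L * (m + 1))) := by
        simp only [← pow_mul, ← pow_add, ← pow_succ']
        ring_nf
    _ ≤ _ := by
        refine Nat.pow_le_pow_right two_pos ?_
        -- The exponent is at most `4 + 3L + 5W + 2LW + 18L + 2L²`; each monomial is at most `L *
        -- W`, and the coefficients add up to `34`.
        nlinarith [Nat.mul_le_mul_left L hm, Nat.mul_le_mul_left L hLW,
          Nat.mul_le_mul hL (hL.trans hLW), Nat.mul_le_mul_left L (hL.trans hLW),
          Nat.mul_le_mul_right W hL]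

theorem union_bound_lt {A a N : ℕ} (ha : 1 ≤ a) (hA : A ≤ 2 ^ (34 * a)) (hN : 2 ^ 17 * a ≤ N) :
    (A : ℝ) * (2 ^ N * Real.exp (-(N : ℝ) / 2048)) < 2 ^ N * (1 / 48) := by
  have hA' : (A : ℝ) ≤ Real.exp (34 * a) := by
    calc (A : ℝ) ≤ 2 ^ (34 * a) := by exact_mod_cast hA
      _ ≤ Real.exp 1 ^ (34 * a) := by
          gcongr
          have := Real.add_one_le_exp 1
          linarith
      _ = Real.exp (34 * a) := by rw [← Real.exp_nat_mul]; push_cast; ring_nf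
  have h48 : (48 : ℝ) < Real.exp 6 := by
    have : Real.exp 6 = Real.exp 1 ^ 6 := by rw [← Real.exp_nat_mul]; norm_num
    rw [this]
    have h2 : (2 : ℝ) ≤ Real.exp 1 := by
      have := Real.add_one_le_exp 1
      linarith
    calc (48 : ℝ) < 2 ^ 6 := by norm_num
      _ ≤ _ := by gcongr
  have ha' : (1 : ℝ) ≤ a := by exact_mod_cast ha
  have hN' : (2 ^ 17 * a : ℝ) ≤ N := by exact_mod_cast hN
  have key : (A : ℝ) * Real.exp (-(N : ℝ) / 2048) ≤ Real.exp (-6) := by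
    calc _ ≤ Real.exp (34 * a) * Real.exp (-(N : ℝ) / 2048) := by gcongr
      _ = Real.exp (34 * a + -(N : ℝ) / 2048) := (Real.exp_add _ _).symm
      _ ≤ _ := Real.exp_le_exp.2 (by linarith)
  have h6 : Real.exp (-6) < 1 / 48 := by
    rw [Real.exp_neg, one_div]
    exact inv_strictAnti₀ (by norm_num) h48
  calc (A : ℝ) * (2 ^ N * Real.exp (-(N : ℝ) / 2048))
      = 2 ^ N * (A * Real.exp (-(N : ℝ) / 2048)) := by ring
    _ < 2 ^ N * (1 / 48) := by gcongr; exact key.trans_lt h6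

theorem distinguisher_size_le {m n k : ℕ} (hn : 1 < n) (hmn : m ≤ n) (hk : 16 * k = 2 ^ m) :
    (2 * k + 1) * (n + 1) + (4 * 2 ^ m + 1 + k * (2 * m + 2)) ≤ 16 * (2 ^ m * n) := by
  rw [← hk]
  have hk0 : 1 ≤ k := by
    have := Nat.one_le_two_pow (n := m)
    omega
  have h1 : k * m ≤ k * n := Nat.mul_le_mul_left k hmn
  have h2 : k * 2 ≤ k * n := Nat.mul_le_mul_left k hn
  have h3 : 1 * n ≤ k * n := Nat.mul_le_mul_right n hk0
  have e1 : (2 * k + 1) * (n + 1) = 2 * (k * n) + 2 * k + n + 1 := by ring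
  have e2 : k * (2 * m + 2) = 2 * (k * m) + 2 * k := by ring
  have e3 : 16 * (16 * k * n) = 256 * (k * n) := by ring
  omega

/-! ### The theorem for a fixed number of relevant bits -/

theorem exists_function_of_count {m j W k : ℕ} (hW : 0 < W) (hk : 16 * k = 2 ^ m)
    (hcount : ((2 * (W + 1) ^ 3 * ((20 * W ^ 2) ^ W * W ^ (m + 1)) : ℕ) : ℝ) *
      (2 ^ (2 ^ m) * Real.exp (-((2 ^ m : ℕ) : ℝ) / 2048)) < 2 ^ (2 ^ m) * (1 / 48)) :
    ∃ f : Cube m → Bool, ∀ M : Model Unit (Answer (m + j)), ModelComplexityLE M W →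
      mean M (fun B => labelProb f ((B ()).map (restrictAnswer (Fin.castAdd j))) *
        distinctProb ((B ()).map (restrictAnswer (Fin.castAdd j))) ^ k) ≤ 9 / 16 + 1 / 48 := by
  classical
  obtain ⟨hfin, hcard⟩ := finite_restrictModel (Fin.castAdd (n := m) j) hW
  have hX : Fintype.card (Cube m) = 2 ^ m := by simp
  have hδ (p : PMF (Answer m)) :
      ((Finset.univ.filter fun f : Cube m → Bool =>
        9 / 16 < labelProb f p * distinctProb p ^ k).card : ℝ≥0∞) ≤
      ENNReal.ofReal (2 ^ (2 ^ m) * Real.exp (-((2 ^ m : ℕ) : ℝ) / 2048)) := by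
    have h := card_accept_le p (k := k) (hk.trans hX.symm) Fintype.card_pos
    rw [hX] at h
    rw [← ENNReal.ofReal_natCast]
    exact ENNReal.ofReal_le_ofReal h
  have hle (f : Cube m → Bool) (p : PMF (Answer m)) : labelProb f p * distinctProb p ^ k ≤ 1 := by
    refine mul_le_one' ?_ (pow_le_one' ?_ k)
    · refine (mean_mono p fun z => ?_).trans (mean_const p 1).le
      split_ifs <;> simp
    · exact distinctProb_add_sum p ▸ le_self_add
  obtain ⟨f, hf⟩ := exists_forall_mean_le hfin.toFinset hle (ε := 1 / 48)
    (ENNReal.div_ne_top (by simp) (by simp)) hδ (by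
      rw [Set.ncard_eq_toFinset_card _ hfin] at hcard
      have h48 : (1 / 48 : ℝ≥0∞) = ENNReal.ofReal (1 / 48) := by
        rw [ENNReal.ofReal_div_of_pos (by norm_num)]; norm_num
      rw [h48, ← ENNReal.ofReal_natCast, ← ENNReal.ofReal_natCast (Fintype.card _),
        ← ENNReal.ofReal_mul (Nat.cast_nonneg _), ← ENNReal.ofReal_mul (Nat.cast_nonneg _),
        Fintype.card_fun, Fintype.card_bool, hX]
      refine (ENNReal.ofReal_lt_ofReal_iff (by positivity)).2 ?_
      rw [Nat.cast_pow 2 (2 ^ m), Nat.cast_ofNat]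
      refine lt_of_le_of_lt ?_ hcount
      gcongr)
  refine ⟨f, fun M hM => ?_⟩
  have := hf (restrictModel (Fin.castAdd j) M) (hfin.mem_toFinset.2 ⟨M, hM, rfl⟩)
  rwa [restrictModel, mean_map] at this

end Indist

open Indist in
theorem mainTheorem9 :
    ∃ (C K : ℝ) (d : ℕ), 0 < C ∧ 0 < K ∧
      ∀ n W : ℕ, 1 < n → 1 < W → (W : ℝ) * Real.logb 2 W ≤ 2 ^ n / C →
        ∃ (f : Indist.Cube n → Bool) (D : Indist.Distinguisher n),
          (D.size : ℝ) ≤ K * (n * W) * Real.logb 2 (n * W) ^ d ∧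
          ∀ M : Indist.Model Unit (Indist.Answer n), Indist.ModelComplexityLE M W →
            1 / 3 < |D.acceptProb (Indist.sampleAccess f) - D.expectedAcceptProb M| := by
  -- `2 ^ m ≤ 2 ^ 19 * W * log W` gives `C`, the value that ensures `m ≤ n`; the distinguisher has
  -- size at most `16 * 2 ^ m * n`, whence `K = 16 * 2 ^ 19`.
  refine ⟨2 ^ 19, 2 ^ 23, 1, by norm_num, by norm_num, fun n W hn hW hWn => ?_⟩
  set L := Nat.clog 2 W with hLdef
  have hWL : W ≤ 2 ^ L := Nat.le_pow_clog one_lt_two W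
  have hL1 : 1 ≤ L := Nat.clog_pos one_lt_two hW
  have hLpred : 2 ^ (L - 1) < W := Nat.pow_pred_clog_lt_self one_lt_two hW
  have hLW : L ≤ W := by
    have := (L - 1).lt_two_pow_self
    omega
  have hlogW : (1 : ℝ) ≤ Real.logb 2 W := by
    rw [Real.le_logb_iff_rpow_le one_lt_two (by positivity), Real.rpow_one]
    exact_mod_cast hW
  have hLlog : (L : ℝ) ≤ 2 * Real.logb 2 W := by
    have : ((L - 1 : ℕ) : ℝ) ≤ Real.logb 2 W := by
      rw [Real.le_logb_iff_rpow_le one_lt_two (by positivity), Real.rpow_natCast]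
      exact_mod_cast hLpred.le
    rw [Nat.cast_sub hL1, Nat.cast_one] at this
    linarith
  -- With `N ≥ Q` the Hoeffding exponent `N / 2048` is at least `64 * L * W`, which beats the `34 *
  -- L * W` from counting models.
  set Q := 2 ^ 17 * (L * W) with hQdef
  have hQ1 : 1 < Q := by
    have := Nat.mul_le_mul hL1 hW.le
    omega
  set m := Nat.clog 2 Q with hmdef
  have hQm : Q ≤ 2 ^ m := Nat.le_pow_clog one_lt_two Q
  have hm1 : 1 ≤ m := Nat.clog_pos one_lt_two hQ1
  have hmpred : 2 ^ (m - 1) < Q := Nat.pow_pred_clog_lt_self one_lt_two hQ1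
  have hmQ : 2 ^ m < 2 * Q := by
    obtain ⟨i, hi⟩ := Nat.exists_eq_add_of_le' hm1
    rw [hi] at hmpred ⊢
    rw [pow_succ]
    simp only [Nat.add_sub_cancel] at hmpred
    omega
  have hmL : m ≤ 17 + 2 * L := by
    have h : 2 ^ (m - 1) < 2 ^ (17 + 2 * L) := by
      calc 2 ^ (m - 1) < Q := hmpred
        _ ≤ 2 ^ 17 * (2 ^ L * 2 ^ L) := by
            rw [hQdef]
            gcongr
            exact L.lt_two_pow_self.le
        _ = 2 ^ (17 + 2 * L) := by ring
    have := (Nat.pow_lt_pow_iff_right one_lt_two).1 h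
    omega
  have hm17 : 4 ≤ m := by
    refine (Nat.pow_le_pow_iff_right one_lt_two).1 (le_trans ?_ hQm)
    have := Nat.mul_le_mul hL1 hW.le
    omega
  have hmW : ((2 ^ m : ℕ) : ℝ) ≤ 2 ^ 19 * (W * Real.logb 2 W) := by
    calc ((2 ^ m : ℕ) : ℝ) ≤ ((2 * Q : ℕ) : ℝ) := by exact_mod_cast hmQ.le
      _ = 2 ^ 18 * W * L := by rw [hQdef]; push_cast; ring
      _ ≤ 2 ^ 18 * W * (2 * Real.logb 2 W) := by gcongr
      _ = _ := by ring
  have hmn : m ≤ n := by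
    refine (Nat.pow_le_pow_iff_right one_lt_two).1 ?_
    rw [le_div_iff₀ (by norm_num)] at hWn
    have : ((2 ^ m : ℕ) : ℝ) ≤ ((2 ^ n : ℕ) : ℝ) := by
      push_cast at hmW ⊢
      linarith
    exact_mod_cast this
  have hk : 16 * 2 ^ (m - 4) = 2 ^ m := by
    rw [show (16 : ℕ) = 2 ^ 4 by norm_num, ← pow_add, Nat.add_sub_cancel' hm17]
  have hcount := union_bound_lt (Nat.mul_le_mul hL1 hW.le) (model_count_le hL1 hLW hWL hmL) hQm
  clear_value m
  obtain ⟨j, rfl⟩ := Nat.exists_eq_add_of_le hmn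
  obtain ⟨f, hf⟩ := exists_function_of_count (j := j) (by omega) hk hcount
  obtain ⟨D, hDsize, hD⟩ := exists_distinguisher (Fin.castAdd j) f (2 ^ (m - 4))
  refine ⟨fun x => f fun i => x (Fin.castAdd j i), D, ?_, fun M hM => ?_⟩
  · have h := hDsize.trans (distinguisher_size_le hn hmn hk)
    have hlog : Real.logb 2 W ≤ Real.logb 2 ((m + j : ℕ) * W) := by
      refine Real.logb_le_logb_of_le one_lt_two (by positivity) ?_
      have : (1 : ℝ) ≤ (m + j : ℕ) := by exact_mod_cast hn.le
      exact le_mul_of_one_le_left (by positivity) this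
    calc (D.size : ℝ) ≤ ((16 * (2 ^ m * (m + j)) : ℕ) : ℝ) := by exact_mod_cast h
      _ = 16 * ((m + j : ℕ) * ((2 ^ m : ℕ) : ℝ)) := by push_cast; ring
      _ ≤ 16 * ((m + j : ℕ) * (2 ^ 19 * (W * Real.logb 2 ((m + j : ℕ) * W)))) := by
          gcongr
          refine hmW.trans ?_
          gcongr
      _ = _ := by ring
  · have h₁ : 15 / 16 ≤ D.acceptProb (sampleAccess fun x => f fun i => x (Fin.castAdd j i)) := by
      rw [Distinguisher.acceptProb, hD, sampleAccess_map_restrictAnswer]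
      exact accept_graph_ge f (by simpa using hk)
    have h₂ : D.expectedAcceptProb M ≤ 9 / 16 + 1 / 48 := by
      have h := hf M hM
      simp only [← hD] at h
      have htop : (9 / 16 + 1 / 48 : ENNReal) ≠ ⊤ := by
        simp [ENNReal.div_eq_top]
      refine (ENNReal.toReal_mono htop h).trans (le_of_eq ?_)
      rw [ENNReal.toReal_add (by simp [ENNReal.div_eq_top]) (by simp)]
      simp
    -- The gap is `15/16 - 9/16 - 1/48 = 17/48`, just above `1/3`.
    refine lt_of_lt_of_le ?_ (le_abs_self _)
    linarith
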